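/- A family of concepts is a pair $F=(U,C)$, where $U$ is a nonempty set and $C$ is a nonempty set of subsets of $U$, called concepts; $F$ is infinite if both $U$ and $C$ are infinite. For $u\in U$ and $c\in C$ put $u(c)=1$ if $u\in c$ and $u(c)=0$ otherwise. A system of equations over $F$ is a finite set $\{v_1(x)=\delta_1,\dots,v_m(x)=\delta_m\}$ with $m\ge 0$, $v_i\in U$, $\delta_i\in\{0,1\}$; it is consistent if it has a solution $x=c\in C$. Let $\mathbb N=\{1,2,\dots\}$ and let $F$ be an infinite family of concepts. - $F\in\mathcal R$ if there is $r\in\mathbb N$ such that every consistent system of equations over $F$ has a subsystem of at most $r$ equations with the same set of solutions on $C$. - $F\in\mathcal D$ if $F$ has finite VC-dimension. - $F\in\mathcal C$ if $F$ is a $k$-family for some $k\in\mathbb N$. Here, for a set $C'$ of subsets of $U$ (possibly empty), $(U,C')$ is a $0$-family if every $u\in U$ is constant on $C'$; and $(U,C')$ is a $(k+1)$-family if it is not an $m$-family for any $m\in\{0,\dots,k\}$ and for every $u\in U$ there are $\delta\in\{0,1\}$ and $m\in\{0,\dots,k\}$ such that $(U,\{c\in C':u(c)=\delta\})$ is an $m$-family.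 - $F\in\mathcal I$ if there is $r\in\mathbb N$ such that every inconsistent system of equations over $F$ has an inconsistent subsystem of at most $r$ equations. The indicator vector of $F$ is $(e_1,e_2,e_3,e_4)\in\{0,1\}^4$, where $e_1=1$ iff $F\in\mathcal R$, $e_2=1$ iff $F\in\mathcal D$, $e_3=1$ iff $F\in\mathcal C$, and $e_4=1$ iff $F\in\mathcal I$. **Theorem.** The indicator vector of every infinite family of concepts is one of the seven rows $$\begin{array}{c|cccc} & \mathcal R&\mathcal D&\mathcal C&\mathcal I\\\hline 1&0&0&0&0\\2&0&0&0&1\\3&0&1&0&0\\4&0&1&0&1\\5&0&1&1&0\\6&0&1&1&1\\7&1&1&0&1\end{array}$$ and each row is the indicator vector of some infinite family of concepts: for $i=1,\dots,7$, row $i$ is the indicator vector of the following infinite family $F_i=(U_i,C_i)$ (distinct symbols denote distinct elements, and all indices range over $\mathbb N$). 1. $U_1=\{0,1\}^{\mathbb N}$ and $C_1=\{c_i : i\in\mathbb N\}$, where $u=(u^{(j)})_{j\in\mathbb N}\in c_i$ iff $u^{(i)}=1$. 2. $U_2=\mathbb N$ and $C_2$ is the set of all subsets of $\mathbb N$. 3.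 $U_3=\{p_i\}\cup\{l_i\}$ and $C_3=\{c_i\}$, where $c_i=\{p_i,l_1,\dots,l_{i-1}\}$ (so $c_1=\{p_1\}$). 4. $U_4=\{u_i\}\cup\{u_{i,j}\}$ and $C_4=\{c_{p,q}\}$, where $u_i\in c_{p,q}$ iff $p>i$, and $u_{i,j}\in c_{p,q}$ iff $(p,q)=(i,j)$. 5. $U_5=\{u_i\}\cup\{u_{i,j}:j\le i\}$ and $C_5=\{c_{i,j}:j\le i\}$, where $u_k\in c_{i,j}$ iff $k=i$, and $u_{k,l}\in c_{i,j}$ iff $(k,l)=(i,j)$. 6. $U_6=\{p_i\}$ and $C_6=\{\{p_i\}\}$. 7. $U_7=\{l_i\}$ and $C_7=\{c_i\}$, where $c_i=\{l_1,\dots,l_{i-1}\}$ (so $c_1=\emptyset$). Consequently, letting $\mathcal F_i$ be the class of the infinite families of concepts whose indicator vector is row $i$, every infinite family of concepts belongs to exactly one of the seven complexity classes $\mathcal F_1,\dots,\mathcal F_7$, and $F_i\in\mathcal F_i$ for each $i$. -/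

import Mathlib

universe u

/-- A family of concepts `F = (U, C)`: a nonempty ground set `U` (given as a type) together with a
nonempty set `C` of subsets of `U`, called concepts. -/
structure ConceptFamily where
  /-- The ground set. -/
  U : Type u
  /-- The set of concepts. -/
  C : Set (Set U)
  nonempty_U : Nonempty U
  nonempty_C : C.Nonempty

namespace ConceptFamily

section Systems

variable {V : Type u}

/-- The solutions on `C` of the finite system of equations `S`; the pair `(u, δ)` stands for the
equation `u(x) = δ`, where `u(c) = 1` if and only if `u ∈ c` (`true` is `1`, `false` is `0`). -/
def solutions (C : Set (Set V)) (S : Finset (V × Bool)) : Set (Set V) :=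
  {c | c ∈ C ∧ ∀ e ∈ S, (e.1 ∈ c ↔ e.2 = true)}

/-- The system `S` is consistent on `C`. -/
def Consistent (C : Set (Set V)) (S : Finset (V × Bool)) : Prop :=
  (solutions C S).Nonempty

/-- `C(u, δ)`, the set of the concepts `c ∈ C` with `u(c) = δ`. -/
def restrict (C : Set (Set V)) (u : V) (δ : Bool) : Set (Set V) :=
  {c | c ∈ C ∧ (u ∈ c ↔ δ = true)}

/-- The finite set `T` is shattered by `C`: every subset of `T` is cut out by a concept. -/
def Shattered (C : Set (Set V)) (T : Finset V) : Prop :=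
  ∀ X : Set V, X ⊆ (T : Set V) → ∃ c ∈ C, (T : Set V) ∩ c = X

/-- `(V, C)` is a `k`-family of concepts. The set `C` may be empty here, because `C(u, δ)` may be;
every function is then constant on `C`, and `(V, C)` is a `0`-family. -/
def IsKFamily : ℕ → Set (Set V) → Prop
  | 0, C => ∀ u : V, ∀ c ∈ C, ∀ c' ∈ C, (u ∈ c ↔ u ∈ c')
  | k + 1, C =>
      (∀ m : ℕ, ∀ _h : m ≤ k, ¬ IsKFamily m C) ∧
        ∀ u : V, ∃ δ : Bool, ∃ m : ℕ, ∃ _h : m ≤ k, IsKFamily m (restrict C u δ)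
  termination_by k => k

end Systems

/-- The ground set and the set of concepts are both infinite. -/
def IsInfinite (F : ConceptFamily.{u}) : Prop :=
  Infinite F.U ∧ F.C.Infinite

/-- `F` is `r`-reduced: every consistent system of equations has a subsystem with at most `r`
equations and the same solutions. -/
def IsReduced (F : ConceptFamily.{u}) (r : ℕ) : Prop :=
  ∀ S : Finset (F.U × Bool), Consistent F.C S →
    ∃ T : Finset (F.U × Bool), T ⊆ S ∧ T.card ≤ r ∧ solutions F.C T = solutions F.C S

/-- `F` is `r`-i-reduced: every inconsistent system of equations has an inconsistent subsystem with
at most `r` equations. -/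
def IsIReduced (F : ConceptFamily.{u}) (r : ℕ) : Prop :=
  ∀ S : Finset (F.U × Bool), ¬ Consistent F.C S →
    ∃ T : Finset (F.U × Bool), T ⊆ S ∧ T.card ≤ r ∧ ¬ Consistent F.C T

/-- The Vapnik-Chervonenkis dimension of `F`: the supremum in `ℕ∞` of the cardinalities of the
shattered sets. -/
noncomputable def vcDim (F : ConceptFamily.{u}) : ℕ∞ :=
  ⨆ (T : Finset F.U) (_ : Shattered F.C T), (T.card : ℕ∞)

/-- The class `R` of the infinite families that are `r`-reduced for some positive `r`. -/
def classR : Set ConceptFamily.{u} :=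
  {F | F.IsInfinite ∧ ∃ r : ℕ, 1 ≤ r ∧ F.IsReduced r}

/-- The class `D` of the infinite families of finite VC-dimension. -/
def classD : Set ConceptFamily.{u} :=
  {F | F.IsInfinite ∧ F.vcDim ≠ ⊤}

/-- The class `C` of the infinite families that are `k`-families for some positive `k`. -/
def classC : Set ConceptFamily.{u} :=
  {F | F.IsInfinite ∧ ∃ k : ℕ, 1 ≤ k ∧ IsKFamily k F.C}

/-- The class `I` of the infinite families that are `r`-i-reduced for some positive `r`. -/
def classI : Set ConceptFamily.{u} :=
  {F | F.IsInfinite ∧ ∃ r : ℕ, 1 ≤ r ∧ F.IsIReduced r}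

open Classical in
/-- The indicator vector of `F`: membership in `R`, `D`, `C`, `I`, in this order. -/
noncomputable def indicator (F : ConceptFamily.{u}) : Fin 4 → Fin 2 :=
  ![if F ∈ classR then 1 else 0,
    if F ∈ classD then 1 else 0,
    if F ∈ classC then 1 else 0,
    if F ∈ classI then 1 else 0]

/-- The seven rows; the columns are `R`, `D`, `C`, `I`. -/
def indicatorRow : Fin 7 → Fin 4 → Fin 2 :=
  ![![0, 0, 0, 0],
    ![0, 0, 0, 1],
    ![0, 1, 0, 0],
    ![0, 1, 0, 1],
    ![0, 1, 1, 0],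
    ![0, 1, 1, 1],
    ![1, 1, 0, 1]]

/-- The complexity class of the infinite families whose indicator vector is row `i`. -/
def complexityClass (i : Fin 7) : Set ConceptFamily.{u} :=
  {F | F.IsInfinite ∧ F.indicator = indicatorRow i}

/-- Elements: all infinite binary sequences. Concepts: `c i`, `i ≥ 1`, with `u ∈ c i` if and only if
the `i`-th term of `u` is `1`. -/
def F₁ : ConceptFamily.{0} where
  U := ℕ+ → Bool
  C := Set.range fun i : ℕ+ => {u | u i = true}
  nonempty_U := inferInstance
  nonempty_C := Set.range_nonempty _

/-- Elements: the positive integers. Concepts: all sets of positive integers. -/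
def F₂ : ConceptFamily.{0} where
  U := ℕ+
  C := Set.univ
  nonempty_U := inferInstance
  nonempty_C := Set.univ_nonempty

/-- The elements `p i` and `l i`, `i ≥ 1`. -/
inductive U₃ : Type
  | p (i : ℕ+)
  | l (i : ℕ+)

/-- Concepts: `c i = {p i, l 1, …, l (i - 1)}`, `i ≥ 1`. -/
def F₃ : ConceptFamily.{0} where
  U := U₃
  C := Set.range fun i : ℕ+ => {x | x = U₃.p i ∨ ∃ j : ℕ+, j < i ∧ x = U₃.l j}
  nonempty_U := ⟨U₃.p 1⟩
  nonempty_C := Set.range_nonempty _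

/-- The elements `u i` and `v i j` (two-index elements), `i, j ≥ 1`. -/
inductive U₄ : Type
  | u (i : ℕ+)
  | v (i j : ℕ+)

/-- Concepts: `c p q`, `p, q ≥ 1`, with `u i ∈ c p q` if and only if `p > i`, and
`v i j ∈ c p q` if and only if `(p, q) = (i, j)`. -/
def F₄ : ConceptFamily.{0} where
  U := U₄
  C := Set.range fun pq : ℕ+ × ℕ+ =>
    {x | (∃ i : ℕ+, pq.1 > i ∧ x = U₄.u i) ∨ x = U₄.v pq.1 pq.2}
  nonempty_U := ⟨U₄.u 1⟩
  nonempty_C := Set.range_nonempty _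

/-- The elements `u i`, `i ≥ 1`, and `v i j` (two-index elements), `1 ≤ j ≤ i`. -/
inductive U₅ : Type
  | u (i : ℕ+)
  | v (i j : ℕ+) (h : j ≤ i)

/-- Concepts: `c i j`, `1 ≤ j ≤ i`, with `u k ∈ c i j` if and only if `k = i`, and
`v k l ∈ c i j` if and only if `(k, l) = (i, j)`. -/
def F₅ : ConceptFamily.{0} where
  U := U₅
  C := {c | ∃ (i j : ℕ+) (h : j ≤ i), c = {U₅.u i, U₅.v i j h}}
  nonempty_U := ⟨U₅.u 1⟩
  nonempty_C := ⟨_, 1, 1, le_rfl, rfl⟩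

/-- Elements: `p i`, `i ≥ 1`, written as `i`. Concepts: the singletons. -/
def F₆ : ConceptFamily.{0} where
  U := ℕ+
  C := Set.range fun i : ℕ+ => {i}
  nonempty_U := inferInstance
  nonempty_C := Set.range_nonempty _

/-- Elements: `l i`, `i ≥ 1`, written as `i`. Concepts: `c i = {l 1, …, l (i - 1)}`, `i ≥ 1`. -/
def F₇ : ConceptFamily.{0} where
  U := ℕ+
  C := Set.range fun i : ℕ+ => {j : ℕ+ | j < i}
  nonempty_U := inferInstance
  nonempty_C := Set.range_nonempty _

/-- The list `F₁, …, F₇`. -/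
def exampleFamily : Fin 7 → ConceptFamily.{0} :=
  ![F₁, F₂, F₃, F₄, F₅, F₆, F₇]

end ConceptFamily

namespace ConceptFamily

/-! ### Shattering, threshold chains and counting in `k`-families -/

section Systems

variable {V : Type u}

/-! Of the sixteen 0-1 vectors exactly seven are compatible with R ⊆ D, C ⊆ D, R ⊆ I and R ∩ C = ∅,
and the seven examples realize all of them.

Requiring a solution to contain a shattered set gives a consistent system without redundant
equations, hence R ⊆ D. A minimal inconsistent system is a consistent one plus one equation, hence R
⊆ I. Fixing the value of one element of a shattered set suitably lowers the index of a `k`-family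
and costs only that element, hence C ⊆ D.

The main point is R ∩ C = ∅: by induction on `k`, an `r`-reduced `k`-family is finite
(`exists_card_bound`). Every element has a side with at most `B` concepts. A system asking for the
other sides excludes at most `B` concepts per equation, so at most `r * B` after reduction; but in a
large family a consistent system of this kind can exclude `r * B + 1`.

For the examples, C is refuted by infinite chains of thresholds (`IsKFamily.chain_length_lt`), and R
and I by systems with more than `r` indispensable equations. Membership in I comes from pairwise
consistency implying consistency, except for `F₇`, where R gives it. -/

theorem solutions_antitone (C : Set (Set V)) {S T : Finset (V × Bool)} (h : T ⊆ S) :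
    solutions C S ⊆ solutions C T :=
  fun _ hc => ⟨hc.1, fun e he => hc.2 e (h he)⟩

theorem isKFamily_zero {C : Set (Set V)} : IsKFamily 0 C ↔ C.Subsingleton := by
  rw [IsKFamily]
  constructor
  · exact fun h c hc c' hc' => Set.ext fun u => h u c hc c' hc'
  · exact fun h u c hc c' hc' => by rw [h hc hc']

theorem isKFamily_succ {k : ℕ} {C : Set (Set V)} : IsKFamily (k + 1) C ↔
    (∀ m ≤ k, ¬ IsKFamily m C) ∧ ∀ u, ∃ δ, ∃ m ≤ k, IsKFamily m (restrict C u δ) := by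
  rw [IsKFamily]
  simp only [exists_prop]

/-- A sufficient condition for being an `m`-family with `m ≤ k + 1`. -/
theorem exists_isKFamily_le_succ {k : ℕ} {C : Set (Set V)}
    (h : ∀ u, ∃ δ, ∃ m ≤ k, IsKFamily m (restrict C u δ)) : ∃ m ≤ k + 1, IsKFamily m C := by
  by_cases h' : ∃ m ≤ k, IsKFamily m C
  · obtain ⟨m, hm, hC⟩ := h'
    exact ⟨m, by omega, hC⟩
  · push Not at h'
    exact ⟨k + 1, le_rfl, isKFamily_succ.2 ⟨h', h⟩⟩

/-- A `k`-family shatters no set with more than `k` elements. -/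
theorem IsKFamily.card_le_of_shattered (k : ℕ) : ∀ (C : Set (Set V)), IsKFamily k C →
    ∀ T : Finset V, Shattered C T → T.card ≤ k := by
  classical
  induction k using Nat.strong_induction_on with
  | _ k ih =>
  intro C hC T hT
  rcases T.eq_empty_or_nonempty with rfl | ⟨u, hu⟩
  · simp
  cases k with
  | zero =>
    exfalso
    rw [isKFamily_zero] at hC
    obtain ⟨c, hc, h1⟩ := hT T subset_rfl
    obtain ⟨c', hc', h2⟩ := hT ∅ (Set.empty_subset _)
    rw [hC hc hc', h2] at h1
    have : u ∈ (T : Set V) := hu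
    rw [← h1] at this
    exact this
  | succ k =>
    obtain ⟨δ, m, hm, hR⟩ := (isKFamily_succ.1 hC).2 u
    have hsh : Shattered (restrict C u δ) (T.erase u) := by
      intro X hX
      have huX : u ∉ X := fun h => by simpa using hX h
      have hXT : X ⊆ (T : Set V) := hX.trans (by simp)
      have hY : X ∪ {v | v = u ∧ δ = true} ⊆ (T : Set V) := by
        rintro v (hv | ⟨rfl, _⟩)
        exacts [hXT hv, hu]
      obtain ⟨c, hc, hcY⟩ := hT _ hY
      have key : ∀ v, (v ∈ T ∧ v ∈ c) ↔ (v ∈ X ∨ (v = u ∧ δ = true)) :=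
        fun v => Set.ext_iff.1 hcY v
      refine ⟨c, ⟨hc, ?_⟩, ?_⟩
      · have := key u
        tauto
      · ext v
        have := key v
        have hv : v ∈ X → v ≠ u := fun h h' => huX (h' ▸ h)
        simp only [Set.mem_inter_iff, Finset.mem_coe, Finset.mem_erase]
        tauto
    have := ih m (by omega) _ hR _ hsh
    rw [Finset.card_erase_of_mem hu] at this
    omega

/-- The length of a chain of thresholds in a `k`-family is less than `2 ^ (k + 1)`. -/
theorem IsKFamily.chain_length_lt (k : ℕ) : ∀ (C : Set (Set V)), IsKFamily k C →
    ∀ (n : ℕ) (v : ℕ → V) (c : ℕ → Set V), (∀ i < n, c i ∈ C) →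
      (∀ i < n, ∀ j < n, (v j ∈ c i ↔ j < i)) → n < 2 ^ (k + 1) := by
  induction k using Nat.strong_induction_on with
  | _ k ih =>
  intro C hC n v c hc hv
  by_contra! hn
  cases k with
  | zero =>
    rw [isKFamily_zero] at hC
    have h01 : c 0 = c 1 := hC (hc 0 (by omega)) (hc 1 (by omega))
    have h0 := hv 0 (by omega) 0 (by omega)
    have h1 := hv 1 (by omega) 0 (by omega)
    rw [h01] at h0
    simp [h0] at h1
  | succ k =>
    have hpow : 2 ^ (k + 1 + 1) = 2 * 2 ^ (k + 1) := by ring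
    have hpos : 0 < 2 ^ (k + 1) := by positivity
    -- The value 0 at the middle threshold keeps the concepts of index below `2 ^ (k + 1)`, the
    -- value 1 those from `2 ^ (k + 1)` on. Either half contains a chain of length `2 ^ (k + 1)`,
    -- too long for an `m`-family with `m ≤ k`.
    obtain ⟨δ, m, hm, hR⟩ := (isKFamily_succ.1 hC).2 (v (2 ^ (k + 1) - 1))
    have hle : 2 ^ (m + 1) ≤ 2 ^ (k + 1) := Nat.pow_le_pow_right (by norm_num) (by omega)
    refine absurd hle (not_le.2 ?_)
    cases δ with
    | false =>
      refine ih m (by omega) _ hR (2 ^ (k + 1)) v c (fun i hi => ⟨hc i (by omega), ?_⟩)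
        fun i hi j hj => hv i (by omega) j (by omega)
      rw [hv i (by omega) _ (by omega)]
      simp only [Bool.false_eq_true, iff_false]
      omega
    | true =>
      refine ih m (by omega) _ hR (2 ^ (k + 1)) (fun j => v (j + 2 ^ (k + 1)))
        (fun i => c (i + 2 ^ (k + 1))) (fun i hi => ⟨hc _ (by omega), ?_⟩) fun i hi j hj => ?_
      · rw [hv _ (by omega) _ (by omega)]
        simp only [iff_true]
        omega
      · rw [hv _ (by omega) _ (by omega)]
        omega

/-- Every consistent system over `C` has an equivalent subsystem of at most `r` equations. -/
def Reduced (C : Set (Set V)) (r : ℕ) : Prop :=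
  ∀ S : Finset (V × Bool), Consistent C S →
    ∃ T : Finset (V × Bool), T ⊆ S ∧ T.card ≤ r ∧ solutions C T = solutions C S

/-- Restricting amounts to adding the equation `(u, δ)` to every system; afterwards it can be erased
from the subsystem found. -/
theorem Reduced.restrict {C : Set (Set V)} {r : ℕ} (h : Reduced C r) (u : V) (δ : Bool) :
    Reduced (restrict C u δ) r := by
  classical
  have hsol : ∀ S, solutions (ConceptFamily.restrict C u δ) S = solutions C (insert (u, δ) S) := by
    intro S
    ext c
    simp [solutions, ConceptFamily.restrict, and_assoc]
  intro S hS
  rw [Consistent, hsol] at hS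
  obtain ⟨T, hTS, hTr, hT⟩ := h _ hS
  refine ⟨T.erase (u, δ), ?_, (Finset.card_erase_le).trans hTr, ?_⟩
  · rwa [← Finset.subset_insert_iff]
  · rw [hsol, hsol, ← hT]
    apply subset_antisymm
    · exact solutions_antitone C (by rw [Finset.subset_insert_iff])
    · intro c hc
      refine ⟨hc.1, fun e he => ?_⟩
      rcases Finset.mem_insert.1 he with rfl | he
      · rw [hT] at hc
        exact hc.2 _ (Finset.mem_insert_self _ _)
      · exact hc.2 e (Finset.mem_of_mem_erase he)

/-- The number of concepts of an `r`-reduced `m`-family with `m ≤ k` is bounded in terms of `k`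
and `r`. -/
theorem exists_card_bound (r k : ℕ) : ∃ B : ℕ, ∀ m ≤ k, ∀ C : Set (Set V), IsKFamily m C →
    Reduced C r → ∀ s : Finset (Set V), (s : Set (Set V)) ⊆ C → s.card ≤ B := by
  classical
  induction k with
  | zero =>
    refine ⟨1, fun m hm C hC _ s hs => ?_⟩
    obtain rfl : m = 0 := by omega
    rw [isKFamily_zero] at hC
    exact Finset.card_le_one.2 fun a ha b hb => hC (hs ha) (hs hb)
  | succ k ih =>
    obtain ⟨B, hB⟩ := ih
    -- Here `r * B + 1` concepts are one more than `r` equations can exclude, and the system built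
    -- from them excludes at most `(r * B + 1) * B`.
    refine ⟨(r * B + 1) * (B + 1), fun m hm C hC hr s hs => ?_⟩
    -- `δ v` marks the small side of v. The second alternative serves the case `m ≤ k`, where `B` is
    -- already a bound and `δ` is arbitrary.
    have hsub : ∃ δ : V → Bool, ∀ v, ∃ m ≤ k, IsKFamily m (restrict C v (δ v)) ∨
        s.card ≤ B := by
      rcases Nat.lt_or_ge k m with hkm | hkm
      · obtain rfl : m = k + 1 := by omega
        choose δ m' h1 h2 using (isKFamily_succ.1 hC).2
        exact ⟨δ, fun v => ⟨m' v, h1 v, Or.inl (h2 v)⟩⟩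
      · exact ⟨fun _ => true, fun _ => ⟨0, by omega, Or.inr (hB m hkm C hC hr s hs)⟩⟩
    by_contra! hlt
    have hsB : ¬ s.card ≤ B := by
      have : B + 1 ≤ (r * B + 1) * (B + 1) := Nat.le_mul_of_pos_left _ (by omega)
      omega
    obtain ⟨δ, hδ⟩ := hsub
    have hG : ∀ v, ∀ t : Finset (Set V), (t : Set (Set V)) ⊆ restrict C v (δ v) → t.card ≤ B := by
      intro v t ht
      obtain ⟨m', hm', h | h⟩ := hδ v
      · exact hB m' hm' _ h (hr.restrict v _) t ht
      · exact absurd h hsB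
    have hcover : ∀ (t : Finset (Set V)) (W : Finset V), (t : Set (Set V)) ⊆ C →
        (∀ c ∈ t, ∃ v ∈ W, (v ∈ c ↔ δ v = true)) → t.card ≤ W.card * B := by
      intro t W htC ht
      have hsub : t ⊆ W.biUnion fun v => t.filter fun c => (v ∈ c ↔ δ v = true) := by
        intro c hc
        obtain ⟨v, hv, h⟩ := ht c hc
        exact Finset.mem_biUnion.2 ⟨v, hv, Finset.mem_filter.2 ⟨hc, h⟩⟩
      refine (Finset.card_le_card hsub).trans (Finset.card_biUnion_le_card_mul _ _ _ fun v _ => ?_)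
      refine hG v _ fun c hc => ?_
      rw [Finset.mem_coe, Finset.mem_filter] at hc
      exact ⟨htC hc.1, hc.2⟩
    have hex : ∀ c : Set V, c ≠ {v | δ v = false} → ∃ v, (v ∈ c ↔ δ v = true) := by
      intro c hc
      by_contra! h
      refine hc (Set.ext fun v => ?_)
      rcases h v with ⟨h1, h2⟩ | ⟨h1, h2⟩
      · simpa [h1] using h2
      · simp [h1, h2]
    -- Only the erased set lies on no small side, so each c in t has an element `f c` whose small
    -- side contains it.
    obtain ⟨t, hts, htc⟩ : ∃ t ⊆ s.erase {v | δ v = false}, t.card = r * B + 1 := by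
      apply Finset.exists_subset_card_eq
      have h1 := Finset.pred_card_le_card_erase (a := {v | δ v = false}) (s := s)
      have h2 : (r * B + 1) * (B + 1) = (r * B + 1) * B + (r * B + 1) := by ring
      omega
    have htC : (t : Set (Set V)) ⊆ C := fun c hc => hs (Finset.mem_of_mem_erase (hts hc))
    have hex' : ∀ c : Set V, ∃ v, c ∈ t → (v ∈ c ↔ δ v = true) := by
      intro c
      by_cases hc : c ∈ t
      · obtain ⟨v, hv⟩ := hex c (Finset.ne_of_mem_erase (hts hc))
        exact ⟨v, fun _ => hv⟩
      · obtain ⟨c', hc'⟩ : t.Nonempty := Finset.card_pos.1 (by omega)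
        obtain ⟨v, -⟩ := hex c' (Finset.ne_of_mem_erase (hts hc'))
        exact ⟨v, fun h => absurd h hc⟩
    choose f hf using hex'
    -- The system asks for the large side at every `f c`. Without a solution, s would be covered by
    -- `r * B + 1` small sides.
    have hcons : Consistent C ((t.image f).image fun v => (v, !δ v)) := by
      by_contra hncons
      have hs' : s.card ≤ (t.image f).card * B := by
        refine hcover s _ hs fun c hc => ?_
        by_contra! h
        refine hncons ⟨c, hs hc, fun e he => ?_⟩
        obtain ⟨v, hv, rfl⟩ := Finset.mem_image.1 he
        rcases h v hv with ⟨h1, h2⟩ | ⟨h1, h2⟩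
        · simp [h1, h2]
        · simp [h1, h2]
      have h1 : (t.image f).card * B ≤ (r * B + 1) * B :=
        Nat.mul_le_mul_right _ (Finset.card_image_le.trans htc.le)
      have h2 : (r * B + 1) * (B + 1) = (r * B + 1) * B + (r * B + 1) := by ring
      omega
    obtain ⟨T, hTS, hTr, hT⟩ := hr _ hcons
    -- Each c in t violates its equation at `f c`, hence fails the equivalent system T; so the at
    -- most `r` small sides belonging to T cover t.
    have ht' : t.card ≤ (T.image Prod.fst).card * B := by
      refine hcover t _ htC fun c hc => ?_
      by_contra! h
      have hcT : c ∈ solutions C T := by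
        refine ⟨htC hc, fun e he => ?_⟩
        have h' := h e.1 (Finset.mem_image_of_mem _ he)
        obtain ⟨v, -, rfl⟩ := Finset.mem_image.1 (hTS he)
        rcases h' with ⟨h1, h2⟩ | ⟨h1, h2⟩
        · simp only [h1, true_iff]
          simpa using h2
        · simp only at h1 h2
          simp [h1, h2]
      rw [hT] at hcT
      have h1 := hcT.2 (f c, !δ (f c))
        (Finset.mem_image_of_mem _ (Finset.mem_image_of_mem _ hc))
      have h2 := hf c hc
      simp only [h2] at h1
      cases hd : δ (f c) <;> simp [hd] at h1
    have h1 : (T.image Prod.fst).card * B ≤ r * B :=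
      Nat.mul_le_mul_right _ (Finset.card_image_le.trans hTr)
    omega

/-- Some pattern is missing on any two elements of one colour, so the colouring is injective on a
shattered set. -/
theorem card_le_two_of_shattered {C : Set (Set V)} (κ : V → Bool)
    (h : ∀ a b, a ≠ b → κ a = κ b → ∃ X : Set V, X ⊆ {a, b} ∧
      ∀ c ∈ C, ¬ ((a ∈ c ↔ a ∈ X) ∧ (b ∈ c ↔ b ∈ X)))
    (T : Finset V) (hT : Shattered C T) : T.card ≤ 2 := by
  refine (Finset.card_le_card_of_injOn κ (t := Finset.univ) (fun _ _ => Finset.mem_univ _)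
    fun a ha b hb hab => ?_).trans (by simp)
  by_contra hne
  obtain ⟨X, hX, hno⟩ := h a b hne hab
  have hXT : X ⊆ (T : Set V) := hX.trans (by rintro v (rfl | rfl) <;> assumption)
  obtain ⟨c, hc, hcX⟩ := hT X hXT
  refine hno c hc ⟨?_, ?_⟩
  · rw [← hcX]
    exact ⟨fun h => ⟨ha, h⟩, fun h => h.2⟩
  · rw [← hcX]
    exact ⟨fun h => ⟨hb, h⟩, fun h => h.2⟩

end Systems

/-! ### Relations between the four classes -/

variable {F : ConceptFamily.{u}}

theorem vcDim_ne_top_of_card_le (N : ℕ) (h : ∀ T, Shattered F.C T → T.card ≤ N) :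
    F.vcDim ≠ ⊤ := by
  have : F.vcDim ≤ N := iSup₂_le fun T hT => by exact_mod_cast h T hT
  exact ne_top_of_le_ne_top (ENat.natCast_ne_top N) this

theorem vcDim_eq_top (h : ∀ n : ℕ, ∃ T, Shattered F.C T ∧ n ≤ T.card) : F.vcDim = ⊤ := by
  rw [ENat.eq_top_iff_forall_ge]
  intro n
  obtain ⟨T, hT, hn⟩ := h n
  exact le_trans (by exact_mod_cast hn) (le_iSup₂ (f := fun (T : Finset F.U)
    (_ : Shattered F.C T) => (T.card : ℕ∞)) T hT)

theorem classR_subset_classD : classR.{u} ⊆ classD := by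
  classical
  rintro F ⟨hF, r, -, hr⟩
  refine ⟨hF, vcDim_ne_top_of_card_le r fun T hT => ?_⟩
  let S : Finset (F.U × Bool) := T.image fun v => (v, true)
  have hS : ∀ c, c ∈ solutions F.C S ↔ c ∈ F.C ∧ (T : Set F.U) ⊆ c := by
    intro c
    simp [S, solutions, Set.subset_def]
  obtain ⟨c, hc, hcT⟩ := hT T subset_rfl
  obtain ⟨S', hS', hcard, hsol⟩ := hr S ⟨c, (hS c).2 ⟨hc, Set.inter_eq_left.1 hcT⟩⟩
  refine le_trans ?_ hcard
  refine le_trans (Finset.card_le_card ?_) (Finset.card_image_le (s := S') (f := Prod.fst))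
  intro v hv
  by_contra hvS
  -- If v does not occur in `S'`, a concept cutting out `T \ {v}` solves `S'` but not S.
  obtain ⟨c', hc', hX⟩ := hT (T \ {v}) Set.sdiff_subset
  have hX' : ∀ w, (w ∈ T ∧ w ∈ c') ↔ (w ∈ T ∧ w ≠ v) := fun w => Set.ext_iff.1 hX w
  have : c' ∈ solutions F.C S' := by
    refine ⟨hc', fun e he => ?_⟩
    obtain ⟨w, hw, rfl⟩ := Finset.mem_image.1 (hS' he)
    have hwv : w ≠ v := by
      rintro rfl
      exact hvS (Finset.mem_image_of_mem Prod.fst he)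
    simpa using ((hX' w).2 ⟨hw, hwv⟩).2
  rw [hsol, hS] at this
  exact ((hX' v).1 ⟨hv, this.2 hv⟩).2 rfl

theorem classC_subset_classD : classC.{u} ⊆ classD := by
  rintro F ⟨hF, k, -, hk⟩
  exact ⟨hF, vcDim_ne_top_of_card_le k fun T hT => hk.card_le_of_shattered k _ T hT⟩

theorem classR_subset_classI : classR.{u} ⊆ classI := by
  classical
  rintro F ⟨hF, r, -, hr⟩
  refine ⟨hF, r + 1, by omega, fun S => ?_⟩
  induction S using Finset.strongInduction with
  | H S ih =>
  intro hS
  by_cases h : ∃ T ⊂ S, ¬ Consistent F.C T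
  · obtain ⟨T, hTS, hT⟩ := h
    obtain ⟨T', h1, h2, h3⟩ := ih T hTS hT
    exact ⟨T', h1.trans hTS.subset, h2, h3⟩
  push Not at h
  obtain ⟨e, he⟩ : S.Nonempty := by
    rw [Finset.nonempty_iff_ne_empty]
    rintro rfl
    obtain ⟨c, hc⟩ := F.nonempty_C
    exact hS ⟨c, hc, by simp⟩
  obtain ⟨T, hTS, hTr, hT⟩ := hr _ (h _ (Finset.erase_ssubset he))
  refine ⟨insert e T, ?_, (Finset.card_insert_le _ _).trans (by omega), ?_⟩
  · exact Finset.insert_subset he (hTS.trans (Finset.erase_subset _ _))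
  · rintro ⟨c, hc⟩
    have hcT : c ∈ solutions F.C T := solutions_antitone _ (Finset.subset_insert _ _) hc
    rw [hT] at hcT
    refine hS ⟨c, hc.1, fun e' he' => ?_⟩
    by_cases hee : e' = e
    · subst hee
      exact hc.2 _ (Finset.mem_insert_self _ _)
    · exact hcT.2 _ (Finset.mem_erase.2 ⟨hee, he'⟩)

theorem notMem_classC_of_mem_classR (h : F ∈ classR) : F ∉ classC := by
  rintro ⟨hF, k, -, hk⟩
  obtain ⟨-, r, -, hr⟩ := h
  obtain ⟨B, hB⟩ := exists_card_bound (V := F.U) r k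
  obtain ⟨s, hs, hcard⟩ := hF.2.exists_subset_card_eq (B + 1)
  have := hB k le_rfl F.C hk hr s hs
  omega

theorem exists_indicator_eq_indicatorRow (F : ConceptFamily.{u}) :
    ∃ i : Fin 7, F.indicator = indicatorRow i := by
  have h1 : F ∈ classR → F ∈ classD := fun h => classR_subset_classD h
  have h2 : F ∈ classC → F ∈ classD := fun h => classC_subset_classD h
  have h3 : F ∈ classR → F ∈ classI := fun h => classR_subset_classI h
  have h4 : F ∈ classR → F ∉ classC := notMem_classC_of_mem_classR
  by_cases hR : F ∈ classR
  · exact ⟨6, by simp [indicator, indicatorRow, hR, h1 hR, h3 hR, h4 hR]⟩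
  by_cases hD : F ∈ classD
  · by_cases hC : F ∈ classC <;> by_cases hI : F ∈ classI
    · exact ⟨5, by simp [indicator, indicatorRow, hR, hD, hC, hI]⟩
    · exact ⟨4, by simp [indicator, indicatorRow, hR, hD, hC, hI]⟩
    · exact ⟨3, by simp [indicator, indicatorRow, hR, hD, hC, hI]⟩
    · exact ⟨2, by simp [indicator, indicatorRow, hR, hD, hC, hI]⟩
  · have hC : F ∉ classC := fun h => hD (h2 h)
    by_cases hI : F ∈ classI
    · exact ⟨1, by simp [indicator, indicatorRow, hR, hD, hC, hI]⟩
    · exact ⟨0, by simp [indicator, indicatorRow, hR, hD, hC, hI]⟩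

theorem indicatorRow_injective : Function.Injective indicatorRow := by
  decide

/-! ### Criteria for the four classes -/

section Criteria

variable {V : Type u}

/-- Every inconsistent system over `C` has an inconsistent subsystem of at most `r` equations. -/
def IReduced (C : Set (Set V)) (r : ℕ) : Prop :=
  ∀ S : Finset (V × Bool), ¬ Consistent C S →
    ∃ T : Finset (V × Bool), T ⊆ S ∧ T.card ≤ r ∧ ¬ Consistent C T

/-- The equation w together with all `v j = 0` is inconsistent, but becomes consistent once any
single `v j = 0` is dropped. -/
theorem not_iReduced {C : Set (Set V)} {r : ℕ} {ι : Type*} [Fintype ι] (hι : r < Fintype.card ι)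
    (w : V × Bool) (v : ι → V)
    (h1 : ∀ c ∈ C, (w.1 ∈ c ↔ w.2 = true) → ∃ j, v j ∈ c)
    (h2 : ∀ j, ∃ c ∈ C, (w.1 ∈ c ↔ w.2 = true) ∧ v j ∈ c ∧ ∀ i, i ≠ j → v i ∉ c) :
    ¬ IReduced C r := by
  classical
  intro hr
  have hv : Function.Injective v := by
    intro i j hij
    by_contra hne
    obtain ⟨c, -, -, hc, hc'⟩ := h2 j
    exact hc' i hne (hij ▸ hc)
  obtain ⟨T, hTS, hTr, hT⟩ := hr (insert w (Finset.univ.image fun j => (v j, false))) (by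
    rintro ⟨c, hc, hS⟩
    obtain ⟨j, hj⟩ := h1 c hc (hS w (Finset.mem_insert_self _ _))
    have := hS (v j, false)
      (Finset.mem_insert_of_mem (Finset.mem_image_of_mem _ (Finset.mem_univ j)))
    simp [hj] at this)
  obtain ⟨j, hj⟩ : ∃ j, (v j, false) ∉ T := by
    by_contra! hall
    have hsub : (Finset.univ.image fun j => (v j, false)) ⊆ T := by
      intro e he
      obtain ⟨j, -, rfl⟩ := Finset.mem_image.1 he
      exact hall j
    have := Finset.card_le_card hsub
    rw [Finset.card_image_of_injective _ fun i j h => hv (Prod.ext_iff.1 h).1,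
      Finset.card_univ] at this
    omega
  obtain ⟨c, hc, hw, -, hoff⟩ := h2 j
  refine hT ⟨c, hc, fun e he => ?_⟩
  rcases Finset.mem_insert.1 (hTS he) with rfl | he'
  · exact hw
  · obtain ⟨i, -, rfl⟩ := Finset.mem_image.1 he'
    have hij : i ≠ j := by
      rintro rfl
      exact hj he
    simpa using hoff i hij

theorem not_reduced {C : Set (Set V)} {r : ℕ} {ι : Type*} [Fintype ι] (hι : r < Fintype.card ι)
    (v : ι → V) (h1 : ∃ c ∈ C, ∀ j, v j ∉ c)
    (h2 : ∀ j, ∃ c ∈ C, v j ∈ c ∧ ∀ i, i ≠ j → v i ∉ c) :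
    ¬ Reduced C r := by
  classical
  intro hr
  have hv : Function.Injective v := by
    intro i j hij
    by_contra hne
    obtain ⟨c, -, hc, hc'⟩ := h2 j
    exact hc' i hne (hij ▸ hc)
  obtain ⟨T, hTS, hTr, hT⟩ := hr (Finset.univ.image fun j => (v j, false)) (by
    obtain ⟨c, hc, hoff⟩ := h1
    refine ⟨c, hc, fun e he => ?_⟩
    obtain ⟨i, -, rfl⟩ := Finset.mem_image.1 he
    simpa using hoff i)
  obtain ⟨j, hj⟩ : ∃ j, (v j, false) ∉ T := by
    by_contra! hall
    have hsub : (Finset.univ.image fun j => (v j, false)) ⊆ T := by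
      intro e he
      obtain ⟨j, -, rfl⟩ := Finset.mem_image.1 he
      exact hall j
    have := Finset.card_le_card hsub
    rw [Finset.card_image_of_injective _ fun i j h => hv (Prod.ext_iff.1 h).1,
      Finset.card_univ] at this
    omega
  obtain ⟨c, hc, hon, hoff⟩ := h2 j
  have hcT : c ∈ solutions C T := by
    refine ⟨hc, fun e he => ?_⟩
    obtain ⟨i, -, rfl⟩ := Finset.mem_image.1 (hTS he)
    have hij : i ≠ j := by
      rintro rfl
      exact hj he
    simpa using hoff i hij
  rw [hT] at hcT
  have := hcT.2 (v j, false) (Finset.mem_image_of_mem _ (Finset.mem_univ j))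
  simp [hon] at this

/-- If every pairwise consistent system is consistent, then the family is `2`-i-reduced. -/
theorem iReduced_two_of_pairwise {C : Set (Set V)}
    (h : ∀ S : Finset (V × Bool), (∀ e ∈ S, ∀ e' ∈ S, ∃ c ∈ C,
      (e.1 ∈ c ↔ e.2 = true) ∧ (e'.1 ∈ c ↔ e'.2 = true)) → Consistent C S) :
    IReduced C 2 := by
  classical
  intro S hS
  by_contra! hT
  refine hS (h S fun e he e' he' => ?_)
  obtain ⟨c, hc, hsat⟩ := hT {e, e'} (by simp [Finset.insert_subset_iff, he, he'])
    Finset.card_le_two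
  exact ⟨c, hc, hsat e (by simp), hsat e' (by simp)⟩

theorem not_isKFamily_of_chain {C : Set (Set V)} (k : ℕ) (v : ℕ → V) (c : ℕ → Set V) (hc : ∀ i, c i ∈ C)
    (h : ∀ i j, v j ∈ c i ↔ j < i) : ¬ IsKFamily k C := by
  intro hk
  exact lt_irrefl _ (hk.chain_length_lt k _ _ v c (fun i _ => hc i) fun i _ j _ => h i j)

end Criteria

theorem mem_classC_of_le (hF : F.IsInfinite) {k : ℕ} (h : ∃ m ≤ k, IsKFamily m F.C) :
    F ∈ classC := by
  obtain ⟨m, -, hm⟩ := h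
  refine ⟨hF, m, ?_, hm⟩
  rcases m.eq_zero_or_pos with rfl | hpos
  · exact absurd (isKFamily_zero.1 hm).finite hF.2
  · exact hpos

/-! ### The seven families -/

/-- The concepts of `F₁`. -/
def C₁ : Set (Set (ℕ+ → Bool)) :=
  Set.range fun i : ℕ+ => {u | u i = true}

/-- The concepts of `F₂`. -/
def C₂ : Set (Set ℕ+) := Set.univ

/-- The concepts of `F₃`. -/
def C₃ : Set (Set U₃) :=
  Set.range fun i : ℕ+ => {x | x = U₃.p i ∨ ∃ j : ℕ+, j < i ∧ x = U₃.l j}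

/-- The concepts of `F₄`. -/
def C₄ : Set (Set U₄) :=
  Set.range fun pq : ℕ+ × ℕ+ =>
    {x | (∃ i : ℕ+, pq.1 > i ∧ x = U₄.u i) ∨ x = U₄.v pq.1 pq.2}

/-- The concepts of `F₅`. -/
def C₅ : Set (Set U₅) :=
  {c | ∃ (i j : ℕ+) (h : j ≤ i), c = {U₅.u i, U₅.v i j h}}

/-- The concepts of `F₆`. -/
def C₆ : Set (Set ℕ+) := Set.range fun i : ℕ+ => {i}

/-- The concepts of `F₇`. -/
def C₇ : Set (Set ℕ+) := Set.range fun i : ℕ+ => {j : ℕ+ | j < i}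

theorem card_Icc_one_succPNat (r : ℕ) :
    Fintype.card (Finset.Icc (1 : ℕ+) r.succPNat) = r + 1 := by
  rw [Fintype.card_coe, PNat.card_Icc]
  simp

theorem F₁_isInfinite : F₁.IsInfinite := by
  refine ⟨inferInstanceAs (Infinite (ℕ+ → Bool)), Set.infinite_range_of_injective ?_⟩
  intro i j hij
  have := Set.ext_iff.1 hij fun k => decide (k = i)
  simp only [Set.mem_ofPred_eq, decide_true, decide_eq_true_eq, true_iff] at this
  exact this.symm

theorem F₁_notMem_classD : F₁ ∉ classD := by
  classical
  rintro ⟨-, h⟩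
  refine h (vcDim_eq_top fun n => ?_)
  -- Concepts are indexed by the finite sets of naturals, so that the concept of index i contains
  -- exactly the `v j` with `j ∈ e i`.
  obtain ⟨e⟩ : Nonempty (ℕ+ ≃ Finset ℕ) :=
    ⟨Equiv.pnatEquivNat.trans (Denumerable.eqv (Finset ℕ)).symm⟩
  let v : ℕ → (ℕ+ → Bool) := fun j i => decide (j ∈ e i)
  have hv : Function.Injective v := by
    intro i j hij
    have := congrFun hij (e.symm {i})
    simp only [v, Equiv.apply_symm_apply, Finset.mem_singleton, decide_true] at this
    exact (by simpa using this : j = i).symm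
  refine ⟨(Finset.range n).image v, ?_, ?_⟩
  · intro X hX
    refine ⟨_, ⟨e.symm ((Finset.range n).filter fun j => v j ∈ X), rfl⟩, ?_⟩
    have key : ∀ j, v j (e.symm ((Finset.range n).filter fun j => v j ∈ X)) = true ↔
        j < n ∧ v j ∈ X := by
      intro j
      simp only [v, Equiv.apply_symm_apply, decide_eq_true_eq, Finset.mem_filter,
        Finset.mem_range]
    ext w
    constructor
    · rintro ⟨hw, hw'⟩
      obtain ⟨j, -, rfl⟩ := Finset.mem_image.1 (Finset.mem_coe.1 hw)
      exact ((key j).1 hw').2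
    · intro hw
      refine ⟨hX hw, ?_⟩
      obtain ⟨j, hj, rfl⟩ := Finset.mem_image.1 (Finset.mem_coe.1 (hX hw))
      exact (key j).2 ⟨Finset.mem_range.1 hj, hw⟩
  · exact (by rw [Finset.card_image_of_injective _ hv, Finset.card_range] :
      ((Finset.range n).image v).card = n).ge

theorem F₁_notMem_classI : F₁ ∉ classI := by
  rintro ⟨-, r, -, hr⟩
  refine not_iReduced (C := C₁) (ι := Finset.Icc (1 : ℕ+) r.succPNat)
    (by rw [card_Icc_one_succPNat]; omega)
    ((fun i => decide (i ≤ r.succPNat) : ℕ+ → Bool), true)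
    (fun j => (fun i => decide (i = j.1) : ℕ+ → Bool)) ?_ ?_ hr
  · rintro _ ⟨i, rfl⟩ hi
    have hi' : i ≤ r.succPNat := by simpa using hi
    exact ⟨⟨i, by simpa using hi'⟩, by simp⟩
  · rintro ⟨j, hj⟩
    refine ⟨_, ⟨j, rfl⟩, ?_, by simp, ?_⟩
    · simpa using hj
    · rintro ⟨i, hi⟩ hij
      simpa using fun h : j = i => hij (Subtype.ext h.symm)

theorem F₂_isInfinite : F₂.IsInfinite :=
  ⟨inferInstanceAs (Infinite ℕ+), (Set.infinite_univ : (Set.univ : Set (Set ℕ+)).Infinite)⟩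

theorem F₂_notMem_classD : F₂ ∉ classD := by
  rintro ⟨-, h⟩
  refine h (vcDim_eq_top fun n => ?_)
  obtain ⟨T, hT⟩ := Infinite.exists_subset_card_eq ℕ+ n
  refine ⟨T, fun X hX => ⟨X, Set.mem_univ _, Set.inter_eq_right.2 hX⟩, hT.ge⟩

theorem F₂_mem_classI : F₂ ∈ classI := by
  refine ⟨F₂_isInfinite, 2, by norm_num, iReduced_two_of_pairwise (C := C₂) fun S h => ?_⟩
  refine ⟨{v | (v, true) ∈ S}, Set.mem_univ _, ?_⟩
  rintro ⟨v, δ⟩ he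
  cases δ with
  | true => simpa using he
  | false =>
    simp only [Set.mem_ofPred_eq, Bool.false_eq_true, iff_false]
    intro he'
    obtain ⟨c, -, h1, h2⟩ := h _ he _ he'
    simp only [Bool.false_eq_true, iff_false, iff_true] at h1 h2
    exact h1 h2

theorem F₃_isInfinite : F₃.IsInfinite := by
  refine ⟨Infinite.of_injective U₃.p fun _ _ h => U₃.p.inj h,
    Set.infinite_range_of_injective ?_⟩
  intro i j hij
  simpa using (Set.ext_iff.1 hij (U₃.p i)).1 (Or.inl rfl)

theorem F₃_mem_classD : F₃ ∈ classD := by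
  refine ⟨F₃_isInfinite, vcDim_ne_top_of_card_le 2
    (card_le_two_of_shattered (C := C₃) (fun | U₃.p _ => true | U₃.l _ => false) ?_)⟩
  -- Two elements `l` are nested, so the larger index never occurs alone; two elements `p` never
  -- occur together.
  have hll : ∀ i j : ℕ+, i < j → ∀ c ∈ C₃, U₃.l j ∈ c → U₃.l i ∈ c := by
    rintro i j hij _ ⟨k, rfl⟩ hj
    simp only [Set.mem_ofPred_eq, reduceCtorEq, false_or, U₃.l.injEq, exists_eq_right'] at hj ⊢
    exact hij.trans hj
  rintro (i | i) (j | j) hne hκ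
  · refine ⟨{U₃.p i, U₃.p j}, subset_rfl, ?_⟩
    rintro _ ⟨k, rfl⟩
    simp only [Set.mem_ofPred_eq, Set.mem_insert_iff, Set.mem_singleton_iff, true_or, or_true,
      iff_true, U₃.p.injEq, reduceCtorEq, and_false, exists_false, or_false]
    rintro ⟨rfl, rfl⟩
    exact hne rfl
  · cases hκ
  · cases hκ
  · have hij : i ≠ j := fun h => hne (by rw [h])
    rcases lt_or_gt_of_ne hij with h | h
    · refine ⟨{U₃.l j}, by simp, fun c hc hX => ?_⟩
      have h1 := hX.1.1 (hll i j h c hc (hX.2.2 rfl))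
      exact hne h1
    · refine ⟨{U₃.l i}, by simp, fun c hc hX => ?_⟩
      have h1 := hX.2.1 (hll j i h c hc (hX.1.2 rfl))
      exact hne h1.symm

theorem F₃_notMem_classC : F₃ ∉ classC := by
  rintro ⟨-, k, -, hk⟩
  refine not_isKFamily_of_chain (C := C₃) k (fun j => U₃.l j.succPNat) _ (fun i => ⟨i.succPNat, rfl⟩) ?_ hk
  intro i j
  simp

theorem F₃_notMem_classI : F₃ ∉ classI := by
  rintro ⟨-, r, -, hr⟩
  refine not_iReduced (C := C₃) (ι := Finset.Icc (1 : ℕ+) r.succPNat)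
    (by rw [card_Icc_one_succPNat]; omega)
    (U₃.l r.succPNat, false) (fun j => U₃.p j.1) ?_ ?_ hr
  · rintro _ ⟨i, rfl⟩ hi
    have hi' : i ≤ r.succPNat := by simpa using hi
    exact ⟨⟨i, by simpa using hi'⟩, by simp⟩
  · rintro ⟨j, hj⟩
    refine ⟨_, ⟨j, rfl⟩, ?_, by simp, ?_⟩
    · simpa using hj
    · rintro ⟨i, hi⟩ hij
      simpa using fun h : i = j => hij (Subtype.ext h)

section F₄

theorem mem_C₄ {c : Set U₄} : c ∈ C₄ ↔ ∃ p q : ℕ+, (∀ i, U₄.u i ∈ c ↔ i < p) ∧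
    ∀ i j, U₄.v i j ∈ c ↔ i = p ∧ j = q := by
  constructor
  · rintro ⟨⟨p, q⟩, rfl⟩
    exact ⟨p, q, by simp, by simp⟩
  · rintro ⟨p, q, h1, h2⟩
    refine ⟨(p, q), Set.ext ?_⟩
    rintro (i | ⟨i, j⟩)
    · simp [h1]
    · simp [h2]

theorem exists_mem_C₄ (p q : ℕ+) : ∃ c ∈ C₄, (∀ i, U₄.u i ∈ c ↔ i < p) ∧
    ∀ i j, U₄.v i j ∈ c ↔ i = p ∧ j = q :=
  ⟨_, ⟨(p, q), rfl⟩, by simp, by simp⟩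

theorem F₄_isInfinite : F₄.IsInfinite := by
  refine ⟨Infinite.of_injective U₄.u fun _ _ h => U₄.u.inj h,
    Set.infinite_range_of_injective ?_⟩
  rintro ⟨p, q⟩ ⟨p', q'⟩ hij
  simpa using (Set.ext_iff.1 hij (U₄.v p q)).1 (Or.inr rfl)

theorem F₄_notMem_classR : F₄ ∉ classR := by
  rintro ⟨-, r, -, hr⟩
  refine not_reduced (C := C₄) (ι := Finset.Icc (1 : ℕ+) r.succPNat)
    (by rw [card_Icc_one_succPNat]; omega) (fun j => U₄.v 1 j.1) ?_ ?_ hr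
  · obtain ⟨c, hc, -, h⟩ := exists_mem_C₄ 2 1
    refine ⟨c, hc, fun j hj => ?_⟩
    exact absurd ((h _ _).1 hj).1 (by decide)
  · intro j
    obtain ⟨c, hc, -, h⟩ := exists_mem_C₄ 1 j.1
    exact ⟨c, hc, (h _ _).2 ⟨rfl, rfl⟩, fun i hij hi => hij (Subtype.ext ((h _ _).1 hi).2)⟩

theorem F₄_mem_classD : F₄ ∈ classD := by
  refine ⟨F₄_isInfinite, vcDim_ne_top_of_card_le 2
    (card_le_two_of_shattered (C := C₄) (fun | U₄.u _ => true | U₄.v _ _ => false) ?_)⟩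
  have hll : ∀ i j : ℕ+, i < j → ∀ c ∈ C₄, U₄.u j ∈ c → U₄.u i ∈ c := by
    intro i j hij c hc hj
    obtain ⟨p, q, h, -⟩ := mem_C₄.1 hc
    exact (h i).2 (hij.trans ((h j).1 hj))
  rintro (i | ⟨i, j⟩) (i' | ⟨i', j'⟩) hne hκ
  · have hij : i ≠ i' := fun h => hne (by rw [h])
    rcases lt_or_gt_of_ne hij with h | h
    · refine ⟨{U₄.u i'}, by simp, fun c hc hX => ?_⟩
      exact hne (hX.1.1 (hll i i' h c hc (hX.2.2 rfl)))
    · refine ⟨{U₄.u i}, by simp, fun c hc hX => ?_⟩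
      exact hne (hX.2.1 (hll i' i h c hc (hX.1.2 rfl))).symm
  · cases hκ
  · cases hκ
  · refine ⟨{U₄.v i j, U₄.v i' j'}, subset_rfl, fun c hc hX => ?_⟩
    obtain ⟨p, q, -, h⟩ := mem_C₄.1 hc
    obtain ⟨rfl, rfl⟩ := (h _ _).1 (hX.1.2 (Or.inl rfl))
    obtain ⟨rfl, rfl⟩ := (h _ _).1 (hX.2.2 (Or.inr rfl))
    exact hne rfl

theorem F₄_notMem_classC : F₄ ∉ classC := by
  rintro ⟨-, k, -, hk⟩
  refine not_isKFamily_of_chain (C := C₄) k (fun j => U₄.u j.succPNat) _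
    (fun i => ⟨(i.succPNat, 1), rfl⟩) ?_ hk
  intro i j
  simp

theorem F₄_mem_classI : F₄ ∈ classI := by
  classical
  refine ⟨F₄_isInfinite, 2, by norm_num, iReduced_two_of_pairwise (C := C₄) fun S h => ?_⟩
  -- An equation `v i j = 1` leaves only one candidate, which pairwise consistency tests against the
  -- rest. Otherwise take q unused in S, which settles all equations in `v`, and the least p
  -- compatible with the equations `u i = 1`.
  by_cases hv : ∃ i j, (U₄.v i j, true) ∈ S
  · obtain ⟨i, j, hij⟩ := hv
    obtain ⟨c, hc, h1, h2⟩ := exists_mem_C₄ i j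
    refine ⟨c, hc, fun e he => ?_⟩
    obtain ⟨c', hc', h3, h4⟩ := h _ hij e he
    obtain ⟨p, q, h5, h6⟩ := mem_C₄.1 hc'
    obtain ⟨rfl, rfl⟩ := (h6 _ _).1 (h3.2 rfl)
    have : c = c' := by
      ext (k | ⟨k, l⟩)
      · exact (h1 k).trans (h5 k).symm
      · exact (h2 k l).trans (h6 k l).symm
    rwa [this]
  push Not at hv
  obtain ⟨q, hq⟩ := Infinite.exists_notMem_finset
    (S.image fun e => match e.1 with | U₄.u _ => (1 : ℕ+) | U₄.v _ j => j)
  have hq' : ∀ p δ, (U₄.v p q, δ) ∉ S := fun p δ hp =>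
    hq (Finset.mem_image.2 ⟨_, hp, rfl⟩)
  obtain ⟨p, hp1, hp2⟩ : ∃ p : ℕ+, (∀ i, (U₄.u i, true) ∈ S → i < p) ∧
      (p = 1 ∨ ∃ i, (U₄.u i, true) ∈ S ∧ p = i + 1) := by
    have hfin : {i | (U₄.u i, true) ∈ S}.Finite :=
      S.finite_toSet.preimage (f := fun i => (U₄.u i, true)) fun i _ j _ hij => by simpa using hij
    rcases {i | (U₄.u i, true) ∈ S}.eq_empty_or_nonempty with he | hne
    · exact ⟨1, fun i hi => absurd hi (Set.ext_iff.1 he i).1, Or.inl rfl⟩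
    · obtain ⟨a, ha, hmax⟩ := hfin.exists_maximal hne
      refine ⟨a + 1, fun i hi => ?_, Or.inr ⟨a, ha, rfl⟩⟩
      rw [PNat.lt_add_one_iff]
      rcases le_total i a with hia | hia
      exacts [hia, hmax hi hia]
  obtain ⟨c, hc, h1, h2⟩ := exists_mem_C₄ p q
  refine ⟨c, hc, ?_⟩
  rintro ⟨i | ⟨i, j⟩, δ⟩ he
  · cases δ with
    | true => simpa [h1] using hp1 i he
    | false =>
      simp only [h1, Bool.false_eq_true, iff_false, not_lt]
      rcases hp2 with rfl | ⟨a, ha, rfl⟩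
      · exact one_le
      · obtain ⟨c', hc', h3, h4⟩ := h _ ha _ he
        obtain ⟨p', q', h5, -⟩ := mem_C₄.1 hc'
        simp only [h5, iff_true, Bool.false_eq_true, iff_false, not_lt] at h3 h4
        exact (PNat.add_one_le_iff.2 h3).trans h4
  · cases δ with
    | true => exact absurd he (hv i j)
    | false =>
      simp only [h2, Bool.false_eq_true, iff_false]
      rintro ⟨rfl, rfl⟩
      exact hq' _ _ he

end F₄

theorem F₅_isInfinite : F₅.IsInfinite := by
  refine ⟨Infinite.of_injective U₅.u fun _ _ h => U₅.u.inj h, ?_⟩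
  refine (Set.infinite_range_of_injective (f := fun i : ℕ+ =>
    ({U₅.u i, U₅.v i 1 one_le} : Set U₅)) ?_).mono ?_
  · intro i j hij
    simpa using (Set.ext_iff.1 hij (U₅.u i)).1 (Or.inl rfl)
  · rintro _ ⟨i, rfl⟩
    exact ⟨i, 1, one_le, rfl⟩

theorem exists_isKFamily_C₅ : ∃ m ≤ 2, IsKFamily m C₅ := by
  have hv : ∀ C ⊆ C₅, ∀ i j h, IsKFamily 0 (restrict C (U₅.v i j h) true) := by
    intro C hC i j h
    rw [isKFamily_zero]
    rintro c ⟨hc, h1⟩ c' ⟨hc', h2⟩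
    obtain ⟨a, b, hab, rfl⟩ := hC hc
    obtain ⟨a', b', hab', rfl⟩ := hC hc'
    simp only [Set.mem_insert_iff, reduceCtorEq, Set.mem_singleton_iff, U₅.v.injEq, false_or,
      iff_true] at h1 h2
    obtain ⟨rfl, rfl⟩ := h1
    obtain ⟨rfl, rfl⟩ := h2
    rfl
  refine exists_isKFamily_le_succ ?_
  rintro (i | ⟨i, j, h⟩)
  · refine ⟨true, exists_isKFamily_le_succ ?_⟩
    rintro (k | ⟨k, l, h⟩)
    -- With `u i = 1` imposed, this is the impossible value of `u k`, so the restriction is empty.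
    · refine ⟨decide (k ≠ i), 0, le_rfl, isKFamily_zero.2 ?_⟩
      rintro c ⟨⟨hc, h1⟩, h2⟩
      exfalso
      obtain ⟨a, b, hab, rfl⟩ := hc
      simp only [Set.mem_insert_iff, reduceCtorEq, Set.mem_singleton_iff, U₅.u.injEq, or_false,
        iff_true] at h1 h2
      subst h1
      simp at h2
    · exact ⟨true, 0, le_rfl, hv _ (fun c hc => hc.1) k l h⟩
  · exact ⟨true, 0, by omega, hv _ subset_rfl i j h⟩

theorem F₅_mem_classC : F₅ ∈ classC :=
  mem_classC_of_le F₅_isInfinite exists_isKFamily_C₅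

theorem F₅_notMem_classI : F₅ ∉ classI := by
  rintro ⟨-, r, -, hr⟩
  refine not_iReduced (C := C₅) (ι := Finset.Icc (1 : ℕ+) r.succPNat)
    (by rw [card_Icc_one_succPNat]; omega)
    (U₅.u r.succPNat, true)
    (fun j => U₅.v r.succPNat j.1 (Finset.mem_Icc.1 j.2).2) ?_ ?_ hr
  · rintro _ ⟨i, j, hij, rfl⟩ hi
    have hi' : r.succPNat = i := by simpa using hi
    subst hi'
    exact ⟨⟨j, by simpa using hij⟩, by simp⟩
  · rintro ⟨j, hj⟩
    refine ⟨_, ⟨r.succPNat, j, (Finset.mem_Icc.1 hj).2, rfl⟩, by simp, by simp, ?_⟩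
    rintro ⟨i, hi⟩ hij
    simpa using fun h : i = j => hij (Subtype.ext h)

theorem F₆_isInfinite : F₆.IsInfinite :=
  ⟨inferInstanceAs (Infinite ℕ+), Set.infinite_range_of_injective Set.singleton_injective⟩

theorem exists_isKFamily_C₆ : ∃ m ≤ 1, IsKFamily m C₆ := by
  refine exists_isKFamily_le_succ fun i => ?_
  refine ⟨true, 0, le_rfl, isKFamily_zero.2 ?_⟩
  rintro _ ⟨⟨j, rfl⟩, h1⟩ _ ⟨⟨k, rfl⟩, h2⟩
  have h1' : i = j := by simpa using h1
  have h2' : i = k := by simpa using h2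
  rw [← h1', ← h2']

theorem F₆_mem_classC : F₆ ∈ classC :=
  mem_classC_of_le F₆_isInfinite exists_isKFamily_C₆

theorem F₆_mem_classI : F₆ ∈ classI := by
  classical
  refine ⟨F₆_isInfinite, 2, by norm_num, iReduced_two_of_pairwise (C := C₆) fun S h => ?_⟩
  by_cases hv : ∃ i, (i, true) ∈ S
  · obtain ⟨i, hi⟩ := hv
    refine ⟨{i}, ⟨i, rfl⟩, fun e he => ?_⟩
    obtain ⟨_, ⟨j, rfl⟩, h1, h2⟩ := h _ hi e he
    have h1' : i = j := by simpa using h1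
    rwa [h1']
  · push Not at hv
    obtain ⟨q, hq⟩ := Infinite.exists_notMem_finset (S.image Prod.fst)
    refine ⟨{q}, ⟨q, rfl⟩, ?_⟩
    rintro ⟨i, δ⟩ he
    cases δ with
    | true => exact absurd he (hv i)
    | false =>
      have : i ≠ q := by
        rintro rfl
        exact hq (Finset.mem_image_of_mem Prod.fst he)
      simpa using this

theorem F₇_isInfinite : F₇.IsInfinite := by
  refine ⟨inferInstanceAs (Infinite ℕ+), Set.infinite_range_of_injective ?_⟩
  intro i j hij
  refine eq_of_forall_lt_iff fun k => ?_
  exact Set.ext_iff.1 hij k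

/-- A system bounds the index i of the concept from below and from above; only the strongest bound
of each kind matters. -/
theorem reduced_two_C₇ : Reduced C₇ 2 := by
  classical
  intro S _
  have hlow : ∃ A ⊆ S, A.card ≤ 1 ∧ ∀ i : ℕ+,
      (∀ e ∈ A, (e.1 < i ↔ e.2 = true)) → ∀ a, (a, true) ∈ S → a < i := by
    rcases (S.filter fun e => e.2 = true).eq_empty_or_nonempty with he | hne
    · refine ⟨∅, by simp, by simp, fun i _ a ha => ?_⟩
      have : (a, true) ∈ S.filter fun e => e.2 = true := by simp [ha]
      simp [he] at this
    · obtain ⟨⟨m, δ⟩, hm, hmax⟩ := Finset.exists_max_image _ Prod.fst hne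
      obtain ⟨hmS, rfl⟩ : (m, δ) ∈ S ∧ δ = true := by simpa using hm
      refine ⟨{(m, true)}, by simpa using hmS, by simp, fun i hi a ha => ?_⟩
      exact (hmax (a, true) (by simp [ha])).trans_lt (by simpa using hi)
  have hupp : ∃ A ⊆ S, A.card ≤ 1 ∧ ∀ i : ℕ+,
      (∀ e ∈ A, (e.1 < i ↔ e.2 = true)) → ∀ a, (a, false) ∈ S → i ≤ a := by
    rcases (S.filter fun e => e.2 = false).eq_empty_or_nonempty with he | hne
    · refine ⟨∅, by simp, by simp, fun i _ a ha => ?_⟩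
      have : (a, false) ∈ S.filter fun e => e.2 = false := by simp [ha]
      simp [he] at this
    · obtain ⟨⟨m, δ⟩, hm, hmin⟩ := Finset.exists_min_image _ Prod.fst hne
      obtain ⟨hmS, rfl⟩ : (m, δ) ∈ S ∧ δ = false := by simpa using hm
      refine ⟨{(m, false)}, by simpa using hmS, by simp, fun i hi a ha => ?_⟩
      exact le_trans (by simpa using hi) (hmin (a, false) (by simp [ha]))
  obtain ⟨A, hAS, hA, hA'⟩ := hlow
  obtain ⟨B, hBS, hB, hB'⟩ := hupp
  refine ⟨A ∪ B, Finset.union_subset hAS hBS, (Finset.card_union_le _ _).trans (by omega), ?_⟩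
  refine subset_antisymm ?_ (solutions_antitone _ (Finset.union_subset hAS hBS))
  rintro _ ⟨⟨i, rfl⟩, hi⟩
  refine ⟨⟨i, rfl⟩, ?_⟩
  have h1 := hA' i fun e he => hi e (Finset.mem_union_left _ he)
  have h2 := hB' i fun e he => hi e (Finset.mem_union_right _ he)
  rintro ⟨a, δ⟩ he
  cases δ with
  | true => simpa using h1 a he
  | false => simpa using h2 a he

theorem F₇_mem_classR : F₇ ∈ classR :=
  ⟨F₇_isInfinite, 2, by norm_num, reduced_two_C₇⟩

theorem exampleFamily_spec (i : Fin 7) : (exampleFamily i).IsInfinite ∧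
    (exampleFamily i).indicator = indicatorRow i := by
  have hRD := @classR_subset_classD.{0}
  have hCD := @classC_subset_classD.{0}
  have hRI := @classR_subset_classI.{0}
  have hRC : ∀ F : ConceptFamily.{0}, F ∈ classR → F ∉ classC :=
    fun F => notMem_classC_of_mem_classR
  fin_cases i
  · refine ⟨F₁_isInfinite, ?_⟩
    have hD := F₁_notMem_classD
    have hI := F₁_notMem_classI
    have hR : F₁ ∉ classR := fun h => hD (hRD h)
    have hC : F₁ ∉ classC := fun h => hD (hCD h)
    simp [exampleFamily, indicator, indicatorRow, hR, hD, hC, hI]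
  · refine ⟨F₂_isInfinite, ?_⟩
    have hD := F₂_notMem_classD
    have hI := F₂_mem_classI
    have hR : F₂ ∉ classR := fun h => hD (hRD h)
    have hC : F₂ ∉ classC := fun h => hD (hCD h)
    simp [exampleFamily, indicator, indicatorRow, hR, hD, hC, hI]
  · refine ⟨F₃_isInfinite, ?_⟩
    have hI := F₃_notMem_classI
    have hR : F₃ ∉ classR := fun h => hI (hRI h)
    simp [exampleFamily, indicator, indicatorRow, hR, F₃_mem_classD, F₃_notMem_classC, hI]
  · refine ⟨F₄_isInfinite, ?_⟩
    simp [exampleFamily, indicator, indicatorRow, F₄_notMem_classR, F₄_mem_classD,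
      F₄_notMem_classC, F₄_mem_classI]
  · refine ⟨F₅_isInfinite, ?_⟩
    have hC := F₅_mem_classC
    have hR : F₅ ∉ classR := fun h => hRC _ h hC
    simp [exampleFamily, indicator, indicatorRow, hR, hCD hC, hC, F₅_notMem_classI]
  · refine ⟨F₆_isInfinite, ?_⟩
    have hC := F₆_mem_classC
    have hR : F₆ ∉ classR := fun h => hRC _ h hC
    simp [exampleFamily, indicator, indicatorRow, hR, hCD hC, hC, F₆_mem_classI]
  · refine ⟨F₇_isInfinite, ?_⟩
    have hR := F₇_mem_classR
    simp [exampleFamily, indicator, indicatorRow, hR, hRD hR, hRC _ hR, hRI hR]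

end ConceptFamily

theorem theorem4 :
    (∀ F : ConceptFamily.{u}, F.IsInfinite →
      ∃ i : Fin 7, F.indicator = ConceptFamily.indicatorRow i) ∧
    (∀ i : Fin 7, (ConceptFamily.exampleFamily i).IsInfinite ∧
      (ConceptFamily.exampleFamily i).indicator = ConceptFamily.indicatorRow i) ∧
    (∀ F : ConceptFamily.{u}, F.IsInfinite →
      ∃! i : Fin 7, F ∈ ConceptFamily.complexityClass i) := by
  refine ⟨fun F _ => F.exists_indicator_eq_indicatorRow, ConceptFamily.exampleFamily_spec,
    fun F hF => ?_⟩
  obtain ⟨i, hi⟩ := F.exists_indicator_eq_indicatorRow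
  exact ⟨i, ⟨hF, hi⟩, fun j hj => ConceptFamily.indicatorRow_injective (hj.2.symm.trans hi)⟩
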